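/- Let $K$ be a finite simplicial complex, $\Gamma$ a group and $\Gamma\to X\to K=X/\Gamma$ a covering (the group $\Gamma$ acts freely and simplicially on the simplicial complex $X$, and the orbits are the fibres of the covering map $X\to K$). Let $k\ge 0$. For a degree $j$, let $X^j$ denote the $j$-simplices of $X$, oriented by lifting to $X$ a total order on the vertices of $K$; for $1\le p\le\infty$ let $\ell^pX^j$ be the space of complex-valued $\ell^p$-functions ($j$-cochains) on $X^j$, and let $d_j$ be the simplicial coboundary from $j$-cochains to $(j+1)$-cochains, dual to the boundary of simplices; it is bounded from $\ell^2X^j$ to $\ell^2X^{j+1}$. Let $A=d_k^*d_k$ on $\ell^2X^k$, let $\Pi_\lambda=\chi_A(\,]0,\lambda])$ be its spectral projections, and let $$F_{\Gamma,k}(\lambda)=\tau_\Gamma(\Pi_\lambda)=\sum_{\sigma}\langle \Pi_\lambda\delta_\sigma,\delta_\sigma\rangle$$ be its spectral density function, where $\tau_\Gamma$ is the von Neumann $\Gamma$-trace and $\sigma$ runs over a fundamental domain for the action of $\Gamma$ on $X^k$. Suppose that there are constants $C$ and $\alpha>2$ such that $F_{\Gamma,k}(\lambda)\le C\lambda^{\alpha/2}$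 for all $\lambda>0$, and that the reduced $\ell^2$-cohomology $$\overline H{}_2^{k+1}(X)=\bigl(\ker d_{k+1}\cap \ell^2X^{k+1}\bigr)\big/\,\overline{d_k(\ell^2X^k)}^{\,\ell^2}$$ vanishes. Then, for every $p\in[1,\infty]$ with $1/p\le 1/2-1/\alpha$, $$B_{p,2}^{k+1}(X):=d_k(\ell^pX^k)\cap \ell^2X^{k+1}=\overline{d_k(\ell^2X^k)}^{\,\ell^2},$$ and the $\ell^{p,2}$-torsion $$T_{p,2}^{k+1}(X)=\overline{B_{p,2}^{k+1}(X)}^{\,\ell^2}\big/\,B_{p,2}^{k+1}(X)$$ vanishes. -/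

import Mathlib

open scoped ENNReal

noncomputable section

namespace L2Torsion

universe u v w

/-! ### Simplices and coverings of simplicial complexes -/

/-- The `k`-simplices of an abstract simplicial complex: its faces with `k + 1` vertices. -/
abbrev Simplex {V : Type u} (X : AbstractSimplicialComplex V) (k : ℕ) : Type u :=
  {s : Finset V // s ∈ X.faces ∧ s.card = k + 1}

instance simplexFintype {W : Type u} [Finite W] (K : AbstractSimplicialComplex W) (k : ℕ) :
    Fintype (Simplex K k) :=
  Fintype.ofFinite _

open Classical in
/-- The codimension one face of a `(k + 1)`-simplex opposite to one of its vertices. -/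
def Simplex.opposite {V : Type u} {X : AbstractSimplicialComplex V} {k : ℕ}
    (σ : Simplex X (k + 1)) (x : V) (hx : x ∈ σ.1) : Simplex X k :=
  ⟨σ.1.erase x, by
    have hc : (σ.1.erase x).card = k + 1 := by
      rw [Finset.card_erase_of_mem hx, σ.2.2]; rfl
    refine ⟨(X.isRelLowerSet_faces σ.2.1).2 (Finset.erase_subset _ _) ?_, hc⟩
    exact Finset.card_pos.mp (by omega)⟩

open Classical in
/-- A covering `Γ → X → K = X / Γ` of simplicial complexes: a surjective simplicial map `X → K`
which is injective on every simplex and has unique lifts of simplices through a given vertex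
(so that it maps the star of each vertex isomorphically onto the star of its image, and is a
covering map of the polyhedra), together with a free simplicial action of the group `Γ` on `X`
whose orbits of vertices are exactly the fibres of the map. -/
structure Covering (Γ : Type w) [Group Γ] {V : Type u} {W : Type v} [MulAction Γ V]
    (X : AbstractSimplicialComplex V) (K : AbstractSimplicialComplex W) where
  /-- The projection on vertices. -/
  proj : V → W
  proj_surjective : Function.Surjective proj
  image_mem : ∀ s ∈ X.faces, s.image proj ∈ K.faces
  injOn : ∀ s ∈ X.faces, Set.InjOn proj s
  existsUnique_lift : ∀ t ∈ K.faces, ∀ x : V, proj x ∈ t →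
    ∃! s : Finset V, s ∈ X.faces ∧ x ∈ s ∧ s.image proj = t
  smul_mem : ∀ (g : Γ), ∀ s ∈ X.faces, s.image (fun x => g • x) ∈ X.faces
  proj_eq_iff : ∀ x y : V, proj x = proj y ↔ ∃ g : Γ, g • x = y
  free : ∀ (g : Γ) (x : V), g • x = x → g = 1

/-! ### Cochains

The vertices of the base `K` are totally ordered. This orders the vertices of every simplex of
`X` in a `Γ`-invariant way, hence orients all simplices of `X`, and a `k`-cochain is a function on
the oriented `k`-simplices. -/

/-- Complex `k`-cochains of `X`. -/
abbrev Cochain {V : Type u} (X : AbstractSimplicialComplex V) (k : ℕ) : Type u :=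
  Simplex X k → ℂ

/-- The Hilbert space `ℓ² X^k` of square summable `k`-cochains. -/
abbrev L2 {V : Type u} (X : AbstractSimplicialComplex V) (k : ℕ) : Type u :=
  lp (fun _ : Simplex X k => ℂ) 2

namespace Covering

section

variable {Γ : Type w} [Group Γ] {V : Type u} {W : Type v} [MulAction Γ V]
  {X : AbstractSimplicialComplex V} {K : AbstractSimplicialComplex W}

open Classical in
theorem exists_lift (π : Covering Γ X K) {k : ℕ} (τ : Simplex K k) :
    ∃ σ : Simplex X k, σ.1.image π.proj = τ.1 := by
  obtain ⟨y, hy⟩ : τ.1.Nonempty := Finset.card_pos.mp (by rw [τ.2.2]; omega)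
  obtain ⟨x, rfl⟩ := π.proj_surjective y
  obtain ⟨s, ⟨hs, -, hst⟩, -⟩ := π.existsUnique_lift τ.1 τ.2.1 x hy
  refine ⟨⟨s, hs, ?_⟩, hst⟩
  rw [← τ.2.2, ← hst, Finset.card_image_of_injOn (π.injOn s hs)]

/-- A chosen simplex of `X` above each simplex of `K`; these lifts form a fundamental domain for
the action of `Γ` on the `k`-simplices of `X`. -/
def lift (π : Covering Γ X K) {k : ℕ} (τ : Simplex K k) : Simplex X k :=
  (π.exists_lift τ).choose

open Classical in
/-- The image in `K` of a simplex of `X`. -/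
def image (π : Covering Γ X K) {k : ℕ} (σ : Simplex X k) : Simplex K k :=
  ⟨σ.1.image π.proj, π.image_mem _ σ.2.1, by
    rw [Finset.card_image_of_injOn (π.injOn _ σ.2.1), σ.2.2]⟩

theorem opposite_inj (π : Covering Γ X K) {k : ℕ} {σ σ' : Simplex X (k + 1)} {x x' : V}
    (hx : x ∈ σ.1) (hx' : x' ∈ σ'.1) (himg : π.image σ = π.image σ')
    (hopp : σ.opposite x hx = σ'.opposite x' hx') : σ = σ' ∧ x = x' := by
  classical
  have he : σ.1.erase x = σ'.1.erase x' := by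
    have h := congrArg Subtype.val hopp
    simp only [Simplex.opposite] at h
    convert h
  have hi : σ.1.image π.proj = σ'.1.image π.proj := by
    have h := congrArg Subtype.val himg
    simp only [Covering.image] at h
    convert h
  obtain ⟨y, hy⟩ : (σ.1.erase x).Nonempty :=
    Finset.card_pos.mp (by rw [Finset.card_erase_of_mem hx, σ.2.2]; omega)
  have hyσ := Finset.mem_of_mem_erase hy
  have hyσ' := Finset.mem_of_mem_erase (he ▸ hy)
  have hu := π.existsUnique_lift _ (π.image_mem _ σ.2.1) y
    (by rw [Finset.mem_image]; exact ⟨y, hyσ, rfl⟩)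
  have hσ : σ.1 = σ'.1 := by
    refine hu.unique ⟨σ.2.1, hyσ, rfl⟩ ⟨σ'.2.1, hyσ', ?_⟩
    convert hi.symm
  refine ⟨Subtype.ext hσ, ?_⟩
  by_contra hne
  have : x ∈ σ'.1.erase x' := Finset.mem_erase.mpr ⟨hne, hσ ▸ hx⟩
  rw [← he] at this
  exact Finset.notMem_erase _ _ this

end

section

variable {Γ : Type w} [Group Γ] {V : Type u} {W : Type v} [LinearOrder W] [MulAction Γ V]
  {X : AbstractSimplicialComplex V} {K : AbstractSimplicialComplex W}

/-- The discrete coboundary `d_k`, dual to the boundary of simplices: if `x₀, …, x_{k+1}` are the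
vertices of `σ` in increasing order, then
`(d_k c)(σ) = ∑ i, (-1)^i c(σ \ {x_i})`. The exponent `i` is the number of vertices of `σ` that
come before `x_i`. -/
def d (π : Covering Γ X K) (k : ℕ) : Cochain X k →ₗ[ℂ] Cochain X (k + 1) where
  toFun c σ := ∑ x : {x // x ∈ σ.1},
    (-1 : ℂ) ^ (σ.1.filter (fun y => π.proj y < π.proj x.1)).card * c (σ.opposite x.1 x.2)
  map_add' c c' := by
    funext σ
    simp only [Pi.add_apply, mul_add, Finset.sum_add_distrib]
  map_smul' a c := by
    funext σ
    simp only [Pi.smul_apply, smul_eq_mul, RingHom.id_apply, Finset.mul_sum]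
    exact Finset.sum_congr rfl fun x _ => by ring

theorem norm_d_sq_le (π : Covering Γ X K) (k : ℕ) (c : Cochain X k) (σ : Simplex X (k + 1)) :
    ‖π.d k c σ‖ ^ 2 ≤ (k + 2 : ℝ) * ∑ x : {x // x ∈ σ.1}, ‖c (σ.opposite x.1 x.2)‖ ^ 2 := by
  have h1 : ‖π.d k c σ‖ ≤ ∑ x : {x // x ∈ σ.1}, ‖c (σ.opposite x.1 x.2)‖ := by
    refine (norm_sum_le _ _).trans (Finset.sum_le_sum fun x _ => ?_)
    simp
  have h2 := sq_sum_le_card_mul_sum_sq (s := (Finset.univ : Finset {x // x ∈ σ.1}))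
    (f := fun x => ‖c (σ.opposite x.1 x.2)‖)
  have h3 : ((Finset.univ : Finset {x // x ∈ σ.1}).card : ℝ) = (k + 2 : ℝ) := by
    rw [Finset.card_univ, Fintype.card_coe, σ.2.2]; push_cast; ring
  rw [h3] at h2
  exact (pow_le_pow_left₀ (norm_nonneg _) h1 2).trans h2

variable [Finite W]

theorem sum_norm_d_sq_le (π : Covering Γ X K) (k : ℕ) (c : L2 X k)
    (s : Finset (Simplex X (k + 1))) :
    ∑ σ ∈ s, ‖π.d k c σ‖ ^ 2 ≤
      ((k + 2 : ℝ) * Fintype.card (Simplex K (k + 1))) * ‖c‖ ^ 2 := by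
  classical
  have hpt : ∀ t : Finset (Simplex X k), ∑ τ ∈ t, ‖c τ‖ ^ 2 ≤ ‖c‖ ^ 2 := fun t => by
    have h := lp.sum_rpow_le_norm_rpow (p := 2) (by norm_num) c t
    simpa using h
  let P : Finset (Σ σ : Simplex X (k + 1), {x // x ∈ σ.1}) := s.sigma fun _ => Finset.univ
  let g : (Σ σ : Simplex X (k + 1), {x // x ∈ σ.1}) → Simplex K (k + 1) × Simplex X k :=
    fun q => (π.image q.1, q.1.opposite q.2.1 q.2.2)
  have hg : Function.Injective g := by
    rintro ⟨σ, x, hx⟩ ⟨σ', x', hx'⟩ h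
    obtain ⟨rfl, rfl⟩ := π.opposite_inj hx hx' (congrArg Prod.fst h) (congrArg Prod.snd h)
    rfl
  calc ∑ σ ∈ s, ‖π.d k c σ‖ ^ 2
      ≤ ∑ σ ∈ s, (k + 2 : ℝ) * ∑ x : {x // x ∈ σ.1}, ‖c (σ.opposite x.1 x.2)‖ ^ 2 :=
        Finset.sum_le_sum fun σ _ => π.norm_d_sq_le k c σ
    _ = (k + 2 : ℝ) * ∑ q ∈ P, ‖c (g q).2‖ ^ 2 := by
        rw [← Finset.mul_sum, Finset.sum_sigma]
    _ = (k + 2 : ℝ) * ∑ r ∈ P.image g, ‖c r.2‖ ^ 2 := by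
        rw [Finset.sum_image hg.injOn]
    _ ≤ (k + 2 : ℝ) * ∑ r ∈ (Finset.univ : Finset (Simplex K (k + 1))) ×ˢ
          ((P.image g).image Prod.snd), ‖c r.2‖ ^ 2 := by
        gcongr
        intro r hr
        exact Finset.mem_product.mpr ⟨Finset.mem_univ _, Finset.mem_image_of_mem _ hr⟩
    _ = (k + 2 : ℝ) * (Fintype.card (Simplex K (k + 1)) *
          ∑ τ ∈ (P.image g).image Prod.snd, ‖c τ‖ ^ 2) := by
        rw [Finset.sum_product]; simp
    _ ≤ (k + 2 : ℝ) * (Fintype.card (Simplex K (k + 1)) * ‖c‖ ^ 2) := by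
        gcongr
        exact hpt _
    _ = _ := by ring

theorem memℓp_d (π : Covering Γ X K) (k : ℕ) (c : L2 X k) : Memℓp (π.d k c) 2 := by
  refine memℓp_gen' (C := ((k + 2 : ℝ) * Fintype.card (Simplex K (k + 1))) * ‖c‖ ^ 2) fun s => ?_
  simpa using π.sum_norm_d_sq_le k c s

/-- The coboundary as a bounded operator `d_k : ℓ² X^k → ℓ² X^{k+1}`. -/
def dL2 (π : Covering Γ X K) (k : ℕ) : L2 X k →L[ℂ] L2 X (k + 1) :=
  LinearMap.mkContinuous
    { toFun := fun c => ⟨π.d k c, π.memℓp_d k c⟩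
      map_add' := fun c c' => by
        ext1
        exact (π.d k).map_add c c'
      map_smul' := fun a c => by
        ext1
        exact (π.d k).map_smul a c }
    (Real.sqrt ((k + 2 : ℝ) * Fintype.card (Simplex K (k + 1))))
    (fun c => by
      refine lp.norm_le_of_forall_sum_le (p := 2) (by norm_num) (by positivity) fun s => ?_
      have h := π.sum_norm_d_sq_le k c s
      rw [← Real.sq_sqrt (by positivity :
        (0 : ℝ) ≤ (k + 2 : ℝ) * Fintype.card (Simplex K (k + 1))), ← mul_pow] at h
      simpa using h)

@[simp]
theorem coe_dL2 (π : Covering Γ X K) (k : ℕ) (c : L2 X k) :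
    (π.dL2 k c : Cochain X (k + 1)) = π.d k c := rfl

/-- `A = d_k^* d_k` acting on `ℓ² X^k`. -/
def A (π : Covering Γ X K) (k : ℕ) : L2 X k →L[ℂ] L2 X k :=
  ContinuousLinearMap.adjoint (π.dL2 k) ∘L π.dL2 k

end

end Covering

/-! ### Spectral projections and the `Γ`-trace -/

section

variable {H : Type u} [NormedAddCommGroup H] [InnerProductSpace ℂ H] [CompleteSpace H]

/-- For a bounded self-adjoint operator `T` and a closed set `S ⊆ ℝ`, the range of the spectral
projection `χ_S(T)`: it consists of the vectors killed by `f(T)` (continuous functional calculus)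
for all continuous `f` vanishing on `S`. -/
def spectralSubspace (T : H →L[ℂ] H) (S : Set ℝ) : Submodule ℂ H :=
  ⨅ f : {f : C(ℝ, ℝ) // ∀ t ∈ S, f t = 0}, LinearMap.ker (cfc (f.1 : ℝ → ℝ) T).toLinearMap

theorem isClosed_spectralSubspace (T : H →L[ℂ] H) (S : Set ℝ) :
    IsClosed (spectralSubspace T S : Set H) := by
  simp only [spectralSubspace, Submodule.coe_iInf]
  exact isClosed_iInter fun f => (cfc (f.1 : ℝ → ℝ) T).isClosed_ker

/-- The range `E_lam` of the spectral projection `χ_T(]0, lam])` of a positive operator `T`: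
the orthogonal complement of `ker T` in the range of `χ_T([0, lam])`. -/
def positiveSpectralSubspace (T : H →L[ℂ] H) (lam : ℝ) : Submodule ℂ H :=
  spectralSubspace T (Set.Icc 0 lam) ⊓ (LinearMap.ker T.toLinearMap)ᗮ

instance (T : H →L[ℂ] H) (lam : ℝ) : CompleteSpace (positiveSpectralSubspace T lam) := by
  refine IsClosed.completeSpace_coe (hs := ?_)
  rw [positiveSpectralSubspace, Submodule.coe_inf]
  exact (isClosed_spectralSubspace T _).inter (Submodule.isClosed_orthogonal _)

/-- The spectral projection `Π_lam = χ_T(]0, lam])` of a positive operator `T`. -/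
def spectralProjection (T : H →L[ℂ] H) (lam : ℝ) : H →L[ℂ] H :=
  (positiveSpectralSubspace T lam).starProjection

end

namespace Covering

variable {Γ : Type w} [Group Γ] {V : Type u} {W : Type v} [MulAction Γ V] [Finite W]
  {X : AbstractSimplicialComplex V} {K : AbstractSimplicialComplex W}

open Classical in
/-- The von Neumann `Γ`-trace `∑ ⟨P δ_σ, δ_σ⟩` of a `Γ`-invariant positive operator `P` on
`ℓ² X^k`, where `σ` runs over a fundamental domain for the action of `Γ` on the `k`-simplices. -/
def gammaTrace (π : Covering Γ X K) {k : ℕ} (P : L2 X k →L[ℂ] L2 X k) : ℝ :=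
  ∑ τ : Simplex K k,
    (inner ℂ (P (lp.single 2 (π.lift τ) (1 : ℂ))) (lp.single 2 (π.lift τ) (1 : ℂ))).re

variable [LinearOrder W]

/-- The spectral density function `F_{Γ,k}(lam) = τ_Γ(χ_A(]0, lam]))` of `A = d_k^* d_k`. -/
def spectralDensity (π : Covering Γ X K) (k : ℕ) (lam : ℝ) : ℝ :=
  π.gammaTrace (spectralProjection (π.A k) lam)

/-! ### Cohomology -/

/-- The closure in `ℓ² X^{k+1}` of `d_k(ℓ² X^k)`. -/
def closedCoboundaries (π : Covering Γ X K) (k : ℕ) : Submodule ℂ (L2 X (k + 1)) :=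
  (LinearMap.range (π.dL2 k).toLinearMap).topologicalClosure

/-- The reduced `ℓ²`-cohomology in degree `k + 1`: the quotient of `ker d_{k+1}` by the closure of
the image of `d_k`. -/
abbrev ReducedL2Cohomology (π : Covering Γ X K) (k : ℕ) : Type u :=
  LinearMap.ker (π.dL2 (k + 1)).toLinearMap ⧸
    (π.closedCoboundaries k).submoduleOf (LinearMap.ker (π.dL2 (k + 1)).toLinearMap)

/-- `B_{p,2}^{k+1}(X) = d_k(ℓ^p X^k) ∩ ℓ² X^{k+1}`, as a subspace of `ℓ² X^{k+1}`. -/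
def B (π : Covering Γ X K) (p : ℝ≥0∞) (k : ℕ) : Submodule ℂ (L2 X (k + 1)) where
  carrier := {b | ∃ c : Cochain X k, Memℓp c p ∧ π.d k c = b}
  zero_mem' := ⟨0, zero_memℓp, (π.d k).map_zero⟩
  add_mem' := by
    rintro _ _ ⟨c, hc, h⟩ ⟨c', hc', h'⟩
    exact ⟨c + c', hc.add hc', by rw [map_add, h, h']; rfl⟩
  smul_mem' := by
    rintro a _ ⟨c, hc, h⟩
    exact ⟨a • c, hc.const_smul a, by rw [map_smul, h]; rfl⟩

/-- The torsion `T_{p,2}^{k+1}(X)` of the `ℓ^{p,2}`-cohomology: the quotient of the `ℓ²`-closure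
of `B_{p,2}^{k+1}(X)` by `B_{p,2}^{k+1}(X)`. -/
abbrev Torsion (π : Covering Γ X K) (p : ℝ≥0∞) (k : ℕ) : Type u :=
  (π.B p k).topologicalClosure ⧸ (π.B p k).submoduleOf (π.B p k).topologicalClosure

end Covering

end L2Torsion

end

/-! One inclusion is formal: `d ∘ d = 0` puts `B` inside `ker d_{k+1}`, which lies in the closed
coboundaries because the reduced cohomology vanishes. The other is a Sobolev inequality `‖x‖_q ≤
const · ‖d x‖₂` for `x` in the range of `A`, where `1/q = 1/2 - 1/α`, that is `q = 2 + 4/(α - 2)`.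
The vectors `d A y` are dense in the closed coboundaries, so a coboundary limit `b` is approximated
by `d x_n` with `x_n = A y_n`; the inequality makes `x_n` converge pointwise to some `c` in `ℓ^q`,
and `d c = b` because `d` is local. Finally `ℓ^q ⊆ ℓ^p` for `p ≥ q`.

The Sobolev inequality combines two facts. By `Γ`-invariance the trace controls every diagonal
coefficient of `Π_lam`, so `|w(σ)| ≤ M lam^(α/4) ‖w‖` for `w` in its range. Also, with `D = ‖d x‖₂`
and `v_j` the part of `x` at frequencies above about `2^j`, spectral calculus gives `∑ 2^j ‖v_j‖² ≤
2 D²`. Splitting `x - v_j` into dyadic bands gives a geometric series, convergent since `α > 2`, so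
`|x(σ) - v_j(σ)| ≤ B D 2^(j(α/4 - 1/2))`. For each `σ`, choose `j` so that this is about half of
`|x(σ)|`; then `|x(σ)|^q` is at most a constant times `D^(q-2) 2^j |v_j(σ)|²`, and summing over `σ`
uses only the energy bound. -/

noncomputable section

namespace L2Torsion

universe u v w

/-! ### Dyadic cut-off functions -/

section Cutoff

/-- A continuous cut-off which vanishes for `t ≤ 2 ^ j` and equals one for `2 ^ (j + 1) ≤ t`. -/
def dyadicCutoff (j : ℤ) (t : ℝ) : ℝ := max 0 (min 1 (t / 2 ^ j - 1))

theorem continuous_dyadicCutoff (j : ℤ) : Continuous (dyadicCutoff j) := by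
  unfold dyadicCutoff
  fun_prop

theorem dyadicCutoff_nonneg (j : ℤ) (t : ℝ) : 0 ≤ dyadicCutoff j t := le_max_left _ _

theorem dyadicCutoff_le_one (j : ℤ) (t : ℝ) : dyadicCutoff j t ≤ 1 :=
  max_le zero_le_one (min_le_left _ _)

theorem dyadicCutoff_of_le {j : ℤ} {t : ℝ} (h : t ≤ 2 ^ j) : dyadicCutoff j t = 0 := by
  have h1 : t / 2 ^ j ≤ 1 := (div_le_one (by positivity)).mpr h
  exact max_eq_left ((min_le_right _ _).trans (by linarith))

theorem dyadicCutoff_of_ge {j : ℤ} {t : ℝ} (h : 2 ^ (j + 1) ≤ t) : dyadicCutoff j t = 1 := by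
  have h1 : 2 ≤ t / 2 ^ j := by
    rw [le_div_iff₀ (by positivity)]
    rwa [zpow_add_one₀ (by norm_num), mul_comm] at h
  rw [dyadicCutoff, min_eq_left (by linarith), max_eq_right zero_le_one]

/-- A dyadic sum is at most twice its largest term. The bound `t` stays quantified so that the
induction can use `2 ^ (a - 1)` for the exponents below the maximum `a`. -/
theorem sum_zpow_le (J : Finset ℤ) : ∀ t : ℝ, 0 ≤ t → (∀ j ∈ J, (2 : ℝ) ^ j ≤ t) →
    ∑ j ∈ J, (2 : ℝ) ^ j ≤ 2 * t := by
  induction J using Finset.induction_on_max with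
  | empty => intro t ht _; simpa using ht
  | insert a s hs ih =>
    intro t _ h
    rw [Finset.sum_insert fun ha => lt_irrefl _ (hs a ha)]
    have h1 := ih ((2 : ℝ) ^ (a - 1)) (by positivity) fun j hj =>
      zpow_le_zpow_right₀ (by norm_num) (by have := hs j hj; omega)
    have h2 := h a (Finset.mem_insert_self _ _)
    rw [zpow_sub_one₀ (by norm_num)] at h1
    linarith

theorem sum_dyadicCutoff_sq_le (J : Finset ℤ) {t : ℝ} (ht : 0 ≤ t) :
    ∑ j ∈ J, (2 : ℝ) ^ j * dyadicCutoff j t ^ 2 ≤ 2 * t := by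
  classical
  calc ∑ j ∈ J, (2 : ℝ) ^ j * dyadicCutoff j t ^ 2
      ≤ ∑ j ∈ J, if (2 : ℝ) ^ j ≤ t then (2 : ℝ) ^ j else 0 := by
        refine Finset.sum_le_sum fun j _ => ?_
        split_ifs with h
        · exact mul_le_of_le_one_right (by positivity)
            (pow_le_one₀ (dyadicCutoff_nonneg j t) (dyadicCutoff_le_one j t))
        · rw [dyadicCutoff_of_le (not_le.mp h).le]; simp
    _ = ∑ j ∈ J with (2 : ℝ) ^ j ≤ t, (2 : ℝ) ^ j := (Finset.sum_filter _ _).symm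
    _ ≤ 2 * t := sum_zpow_le _ t ht fun j hj => (Finset.mem_filter.mp hj).2

/-- The band vanishes for `t ≤ 2 ^ j` and is at most one in absolute value elsewhere, where `t / 2 ^
j ≥ 1`. -/
theorem dyadicCutoff_sub_sq_le (j : ℤ) {t : ℝ} (ht : 0 ≤ t) :
    (dyadicCutoff j t - dyadicCutoff (j + 1) t) ^ 2 ≤ ((2 : ℝ) ^ j)⁻¹ * t := by
  have h0 := dyadicCutoff_nonneg j t
  have h1 := dyadicCutoff_le_one j t
  have h2 := dyadicCutoff_nonneg (j + 1) t
  have h3 := dyadicCutoff_le_one (j + 1) t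
  rcases le_total t (2 ^ j) with h | h
  · rw [dyadicCutoff_of_le h, dyadicCutoff_of_le
      (h.trans (zpow_le_zpow_right₀ (by norm_num) (by omega)))]
    simp only [sub_self, ne_eq, OfNat.ofNat_ne_zero, not_false_eq_true, zero_pow]
    positivity
  · have h4 : 1 ≤ ((2 : ℝ) ^ j)⁻¹ * t := by
      rw [inv_mul_eq_div, le_div_iff₀ (by positivity)]; simpa using h
    refine le_trans ?_ h4
    rw [sq_le_one_iff_abs_le_one, abs_le]
    constructor <;> linarith

theorem sub_dyadicCutoff_mul_sq_le (j : ℤ) {t : ℝ} (ht : 0 ≤ t) :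
    (t - dyadicCutoff j t * t) ^ 2 ≤ ((2 : ℝ) ^ (j + 1)) ^ 2 := by
  have h0 := dyadicCutoff_nonneg j t
  have h1 := dyadicCutoff_le_one j t
  rcases le_total ((2 : ℝ) ^ (j + 1)) t with h | h
  · rw [dyadicCutoff_of_ge h]; simp; positivity
  · refine pow_le_pow_left₀ ?_ ?_ 2 <;> nlinarith

end Cutoff

/-! ### Functional calculus of a positive operator -/

section Calculus

variable {H : Type u} [NormedAddCommGroup H] [InnerProductSpace ℂ H] [CompleteSpace H]

theorem norm_cfc_apply_sq (T : H →L[ℂ] H) {f : ℝ → ℝ} (hf : Continuous f) (x : H) :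
    ‖cfc f T x‖ ^ 2 = (inner ℂ (cfc (fun t => f t ^ 2) T x) x).re := by
  have h1 : cfc (fun t => f t ^ 2) T = cfc f T * cfc f T := by
    by_cases hT : IsSelfAdjoint T
    · rw [← cfc_mul f f T hf.continuousOn hf.continuousOn]
      simp only [sq]
    -- The calculus takes the default value zero when `T` is not self-adjoint.
    · simp [cfc_apply_of_not_predicate T hT]
  have h2 : IsSelfAdjoint (cfc f T) := IsSelfAdjoint.cfc
  rw [h1, mul_apply_eq_comp, ← ContinuousLinearMap.adjoint_inner_right,
    h2.adjoint_eq, inner_self_eq_norm_sq_to_K]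
  norm_cast

/-- The spectrum of a positive operator lies in `[0, ∞)`. This carries the scalar cut-off estimates
over to quadratic forms. -/
theorem re_inner_cfc_le {T : H →L[ℂ] H} (hT : 0 ≤ T) {f g : ℝ → ℝ} (hf : Continuous f)
    (hg : Continuous g) (hfg : ∀ t, 0 ≤ t → f t ≤ g t) (x : H) :
    (inner ℂ (cfc f T x) x).re ≤ (inner ℂ (cfc g T x) x).re := by
  have h : cfc f T ≤ cfc g T :=
    cfc_mono (fun t ht => hfg t (spectrum_nonneg_of_nonneg hT ht)) hf.continuousOn hg.continuousOn
  have h2 := ((ContinuousLinearMap.le_def _ _).mp h).re_inner_nonneg_left x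
  simp only [sub_apply, inner_sub_left, map_sub, RCLike.re_to_complex] at h2
  linarith

theorem re_inner_cfc_const_mul {T : H →L[ℂ] H} (hT : 0 ≤ T) (a : ℝ) (x : H) :
    (inner ℂ (cfc (fun t => a * t) T x) x).re = a * (inner ℂ (T x) x).re := by
  have hsa : IsSelfAdjoint T := IsSelfAdjoint.of_nonneg hT
  rw [cfc_const_mul_id a T]
  simp [inner_smul_left_eq_smul]

theorem sum_zpow_mul_norm_dyadicCutoff_sq_le {T : H →L[ℂ] H} (hT : 0 ≤ T) (J : Finset ℤ)
    (x : H) :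
    ∑ j ∈ J, (2 : ℝ) ^ j * ‖cfc (dyadicCutoff j) T x‖ ^ 2 ≤ 2 * (inner ℂ (T x) x).re := by
  have hc : ∀ j : ℤ, Continuous fun t => (2 : ℝ) ^ j * dyadicCutoff j t ^ 2 := fun j =>
    continuous_const.mul ((continuous_dyadicCutoff j).pow 2)
  have h1 : ∑ j ∈ J, (2 : ℝ) ^ j * ‖cfc (dyadicCutoff j) T x‖ ^ 2 =
      (inner ℂ (cfc (fun t => ∑ j ∈ J, (2 : ℝ) ^ j * dyadicCutoff j t ^ 2) T x) x).re := by
    have h2 : (fun t => ∑ j ∈ J, (2 : ℝ) ^ j * dyadicCutoff j t ^ 2) =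
        ∑ j ∈ J, fun t => (2 : ℝ) ^ j * dyadicCutoff j t ^ 2 := by
      funext t; simp
    rw [h2, cfc_sum _ _ _ fun j _ => (hc j).continuousOn, sum_apply,
      sum_inner, Complex.re_sum]
    refine Finset.sum_congr rfl fun j _ => ?_
    rw [norm_cfc_apply_sq T (continuous_dyadicCutoff j),
      cfc_const_mul _ (fun t => dyadicCutoff j t ^ 2) _
        ((continuous_dyadicCutoff j).pow 2).continuousOn, smul_apply, inner_smul_left_eq_smul,
      Complex.smul_re, smul_eq_mul]
  rw [h1, ← re_inner_cfc_const_mul hT]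
  exact re_inner_cfc_le hT (continuous_finsetSum _ fun j _ => hc j)
    (continuous_const.mul continuous_id) (fun t ht => sum_dyadicCutoff_sq_le J ht) x

theorem cfc_dyadicCutoff_sub {T : H →L[ℂ] H} (j : ℤ) (x : H) :
    cfc (dyadicCutoff j) T x - cfc (dyadicCutoff (j + 1)) T x =
      cfc (fun t => dyadicCutoff j t - dyadicCutoff (j + 1) t) T x := by
  rw [cfc_sub _ _ T (continuous_dyadicCutoff j).continuousOn
    (continuous_dyadicCutoff (j + 1)).continuousOn]
  rfl

theorem norm_cfc_dyadicCutoff_sub_sq_le {T : H →L[ℂ] H} (hT : 0 ≤ T) (j : ℤ) (x : H) :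
    ‖cfc (dyadicCutoff j) T x - cfc (dyadicCutoff (j + 1)) T x‖ ^ 2 ≤
      ((2 : ℝ) ^ j)⁻¹ * (inner ℂ (T x) x).re := by
  have hc : Continuous fun t => dyadicCutoff j t - dyadicCutoff (j + 1) t :=
    (continuous_dyadicCutoff j).sub (continuous_dyadicCutoff (j + 1))
  rw [cfc_dyadicCutoff_sub, norm_cfc_apply_sq T hc, ← re_inner_cfc_const_mul hT]
  exact re_inner_cfc_le hT (hc.pow 2) (continuous_const.mul continuous_id)
    (fun t ht => dyadicCutoff_sub_sq_le j ht) x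

/-- The factor `t` puts the vector in the range of the self-adjoint `T`, hence orthogonal to its
kernel; the vanishing of `h` beyond `lam` gives the spectral support. -/
theorem cfc_mul_apply_mem_positiveSpectralSubspace {T : H →L[ℂ] H} (hT : 0 ≤ T) {h : ℝ → ℝ}
    (hh : Continuous h) {lam : ℝ} (hlam : ∀ t, lam < t → h t = 0) (x : H) :
    cfc (fun t => t * h t) T x ∈ positiveSpectralSubspace T lam := by
  have hsa : IsSelfAdjoint T := IsSelfAdjoint.of_nonneg hT
  constructor
  · simp only [spectralSubspace, SetLike.mem_coe, Submodule.mem_iInf]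
    rintro ⟨f, hf⟩
    have h1 : cfc (f : ℝ → ℝ) T * cfc (fun t => t * h t) T = 0 := by
      rw [← cfc_mul (f : ℝ → ℝ) (fun t => t * h t) T f.continuous.continuousOn
        (continuous_id.mul hh).continuousOn]
      rw [← cfc_zero ℝ T]
      refine cfc_congr fun t ht => ?_
      have ht0 := spectrum_nonneg_of_nonneg hT ht
      rcases le_or_gt t lam with h2 | h2
      · simp [hf t ⟨ht0, h2⟩]
      · simp [hlam t h2]
    exact congrArg (fun S : H →L[ℂ] H => S x) h1
  · have h1 : cfc (fun t => t * h t) T = T * cfc h T := by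
      rw [cfc_mul (fun t => t) h T continuous_id.continuousOn hh.continuousOn, cfc_id' ℝ T]
    rw [h1, mul_apply_eq_comp, SetLike.mem_coe, Submodule.mem_orthogonal]
    intro y hy
    rw [← ContinuousLinearMap.adjoint_inner_left, hsa.adjoint_eq,
      show T y = 0 from hy, inner_zero_left]

theorem cfc_dyadicCutoff_sub_mem {T : H →L[ℂ] H} (hT : 0 ≤ T) (j : ℤ) (x : H) :
    cfc (dyadicCutoff j) T x - cfc (dyadicCutoff (j + 1)) T x ∈
      positiveSpectralSubspace T (2 ^ (j + 2)) := by
  -- The band must be written as `t * h t` with `h` continuous. Replacing the denominator `t` by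
  -- `max t (2 ^ j)` is harmless because the numerator vanishes for `t ≤ 2 ^ j`.
  set h : ℝ → ℝ := fun t =>
    (dyadicCutoff j t - dyadicCutoff (j + 1) t) / max t (2 ^ j) with hdef
  have hpos : ∀ t : ℝ, 0 < max t ((2 : ℝ) ^ j) := fun t => lt_max_of_lt_right (by positivity)
  have hh : Continuous h :=
    ((continuous_dyadicCutoff j).sub (continuous_dyadicCutoff (j + 1))).div
      (continuous_id.max continuous_const) fun t => (hpos t).ne'
  have h1 : (fun t => dyadicCutoff j t - dyadicCutoff (j + 1) t) = fun t => t * h t := by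
    funext t
    rcases le_total t ((2 : ℝ) ^ j) with ht | ht
    · simp [hdef, dyadicCutoff_of_le ht, dyadicCutoff_of_le
        (ht.trans (zpow_le_zpow_right₀ (by norm_num) (by omega : j ≤ j + 1)))]
    · have h2 : t ≠ 0 := (lt_of_lt_of_le (by positivity) ht).ne'
      simp only [hdef, max_eq_left ht]
      field_simp
  rw [cfc_dyadicCutoff_sub, h1]
  refine cfc_mul_apply_mem_positiveSpectralSubspace hT hh (fun t ht => ?_) x
  have h3 : (2 : ℝ) ^ (j + 1 + 1) ≤ t := by rw [add_assoc]; exact ht.le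
  simp [hdef, dyadicCutoff_of_ge h3, dyadicCutoff_of_ge
    ((zpow_le_zpow_right₀ (by norm_num) (by omega : j + 1 ≤ j + 1 + 1)).trans h3)]

/-- On the range of `T` the cut-offs recover the vector as `j → -∞`, with an explicit rate; no
component in `ker T` is lost. -/
theorem norm_sub_cfc_dyadicCutoff_le {T : H →L[ℂ] H} (hT : 0 ≤ T) (j : ℤ) (y : H) :
    ‖T y - cfc (dyadicCutoff j) T (T y)‖ ≤ 2 ^ (j + 1) * ‖y‖ := by
  have hsa : IsSelfAdjoint T := IsSelfAdjoint.of_nonneg hT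
  have hc : Continuous fun t => t - dyadicCutoff j t * t :=
    continuous_id.sub ((continuous_dyadicCutoff j).mul continuous_id)
  have h1 : T y - cfc (dyadicCutoff j) T (T y) = cfc (fun t => t - dyadicCutoff j t * t) T y := by
    rw [cfc_sub (fun t => t) (fun t => dyadicCutoff j t * t) T continuous_id.continuousOn
      ((continuous_dyadicCutoff j).mul continuous_id).continuousOn,
      cfc_mul _ (fun t => t) T (continuous_dyadicCutoff j).continuousOn continuous_id.continuousOn,
      cfc_id' ℝ T]
    rfl
  refine le_of_sq_le_sq ?_ (by positivity)
  rw [h1, norm_cfc_apply_sq T hc]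
  refine (re_inner_cfc_le hT (hc.pow 2) continuous_const
    (fun t ht => sub_dyadicCutoff_mul_sq_le j ht) y).trans ?_
  rw [cfc_const _ T]
  rw [Algebra.algebraMap_eq_smul_one]
  simp only [smul_apply, one_apply_eq_self, inner_smul_left_eq_smul, Complex.smul_re,
    inner_self_eq_norm_sq_to_K, mul_pow, smul_eq_mul]
  norm_cast

/-- A pointwise bound of the low frequency part. -/
theorem norm_sub_cfc_dyadicCutoff_apply_le {T : H →L[ℂ] H} (hT : 0 ≤ T) {M α : ℝ} (hM : 0 ≤ M)
    (hα : 2 < α) (ev : H →L[ℂ] ℂ)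
    (hev : ∀ lam : ℝ, 0 < lam → ∀ w ∈ positiveSpectralSubspace T lam,
      ‖ev w‖ ≤ M * lam ^ (α / 4) * ‖w‖) (j : ℤ) (y : H) :
    ‖ev (T y) - ev (cfc (dyadicCutoff j) T (T y))‖ ≤
      M * 4 ^ (α / 4) * √(inner ℂ (T (T y)) (T y)).re / (2 ^ (α / 4 - 1 / 2) - 1) *
        ((2 : ℝ) ^ (α / 4 - 1 / 2)) ^ j := by
  set D : ℝ := √(inner ℂ (T (T y)) (T y)).re with hD
  set r : ℝ := (2 : ℝ) ^ (α / 4 - 1 / 2) with hr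
  have hr1 : 1 < r := Real.one_lt_rpow (by norm_num) (by linarith)
  have hr0 : 0 < r - 1 := by linarith
  set v : ℤ → ℂ := fun i => ev (cfc (dyadicCutoff i) T (T y)) with hv
  -- The band lies in the spectral subspace up to `2 ^ (i + 2)`, whence `4 ^ (α / 4)`, and has norm
  -- at most `2 ^ (-i / 2) * D`.
  have hstep : ∀ i : ℤ, ‖v i - v (i + 1)‖ ≤ M * 4 ^ (α / 4) * D * r ^ i := by
    intro i
    have h2i : (0 : ℝ) < 2 ^ i := by positivity
    have h1 := hev (2 ^ (i + 2)) (by positivity) _ (cfc_dyadicCutoff_sub_mem hT i (T y))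
    have h2 : ‖cfc (dyadicCutoff i) T (T y) - cfc (dyadicCutoff (i + 1)) T (T y)‖ ≤
        ((2 : ℝ) ^ i) ^ (-(1 / 2) : ℝ) * D := by
      have h3 := Real.sqrt_le_sqrt (norm_cfc_dyadicCutoff_sub_sq_le hT i (T y))
      rw [Real.sqrt_sq (norm_nonneg _), Real.sqrt_mul (by positivity)] at h3
      rwa [Real.rpow_neg h2i.le, ← Real.sqrt_eq_rpow, ← Real.sqrt_inv]
    rw [map_sub] at h1
    have h4 : r ^ i = ((2 : ℝ) ^ i) ^ (α / 4) * ((2 : ℝ) ^ i) ^ (-(1 / 2) : ℝ) := by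
      rw [← Real.rpow_add h2i, hr, ← Real.rpow_intCast, ← Real.rpow_intCast,
        ← Real.rpow_mul (by norm_num), ← Real.rpow_mul (by norm_num)]
      congr 1; ring
    have h5 : ((2 : ℝ) ^ (i + 2)) ^ (α / 4) = 4 ^ (α / 4) * ((2 : ℝ) ^ i) ^ (α / 4) := by
      rw [zpow_add₀ (by norm_num), ← Real.mul_rpow (by norm_num) h2i.le]
      congr 1; norm_num; ring
    calc ‖v i - v (i + 1)‖ ≤ _ := h1
      _ ≤ M * ((2 : ℝ) ^ (i + 2)) ^ (α / 4) * (((2 : ℝ) ^ i) ^ (-(1 / 2) : ℝ) * D) := by gcongr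
      _ = _ := by rw [h4, h5]; ring
  -- Telescoping, with the geometric sum in closed form; it stays bounded as `n` grows because `r >
  -- 1`.
  have htel : ∀ n : ℕ, ‖v (j - n) - v j‖ ≤
      M * 4 ^ (α / 4) * D * ((r ^ j - r ^ (j - n : ℤ)) / (r - 1)) := by
    intro n
    induction n with
    | zero => simp
    | succ n ih =>
      have h1 := hstep (j - (n + 1 : ℕ))
      rw [show j - ((n + 1 : ℕ) : ℤ) + 1 = j - n by push_cast; ring] at h1
      have h2 : r ^ (j - n : ℤ) = r ^ (j - (n + 1 : ℕ) : ℤ) * r := by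
        rw [← zpow_add_one₀ (by linarith)]; congr 1; push_cast; ring
      calc ‖v (j - (n + 1 : ℕ)) - v j‖
          ≤ ‖v (j - (n + 1 : ℕ)) - v (j - n)‖ + ‖v (j - n) - v j‖ := 
            norm_sub_le_norm_sub_add_norm_sub _ _ _
        _ ≤ _ := add_le_add h1 ih
        _ = _ := by rw [h2]; field_simp; ring
  have hlim : Filter.Tendsto (fun n : ℕ => v (j - n)) Filter.atTop (nhds (ev (T y))) := by
    refine (ev.continuous.tendsto _).comp ?_
    rw [tendsto_iff_norm_sub_tendsto_zero]
    have h1 : Filter.Tendsto (fun n : ℕ => (2 : ℝ) ^ (j + 1) * ‖y‖ * (1 / 2) ^ n) Filter.atTop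
        (nhds 0) := by
      simpa using (tendsto_pow_atTop_nhds_zero_of_lt_one (r := (1 / 2 : ℝ)) (by norm_num)
        (by norm_num)).const_mul ((2 : ℝ) ^ (j + 1) * ‖y‖)
    refine squeeze_zero (fun _ => norm_nonneg _) (fun n => ?_) h1
    rw [norm_sub_rev]
    refine (norm_sub_cfc_dyadicCutoff_le hT _ y).trans_eq ?_
    rw [show j - (n : ℤ) + 1 = (j + 1) - n by ring, zpow_sub₀ (by norm_num), zpow_natCast]
    rw [one_div, inv_pow]; ring
  refine le_of_tendsto (hlim.sub_const (v j)).norm (Filter.Eventually.of_forall fun n => ?_)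
  refine (htel n).trans ?_
  rw [mul_div_assoc', div_mul_eq_mul_div]
  gcongr
  have : 0 < r ^ (j - n : ℤ) := zpow_pos (by linarith) _
  linarith

end Calculus

/-! ### The Sobolev inequality -/

section Sobolev

variable {H : Type u} [NormedAddCommGroup H] [InnerProductSpace ℂ H] [CompleteSpace H]

/-- The Sobolev inequality on the range of `T`, for a family `ev` of coordinates satisfying
Bessel's inequality. -/
theorem exists_sobolev_constant {ι : Type*} {T : H →L[ℂ] H} (hT : 0 ≤ T) (ev : ι → H →L[ℂ] ℂ)
    (hbessel : ∀ (w : H) (s : Finset ι), ∑ i ∈ s, ‖ev i w‖ ^ 2 ≤ ‖w‖ ^ 2)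
    {M α : ℝ} (hM : 0 < M) (hα : 2 < α)
    (hev : ∀ lam : ℝ, 0 < lam → ∀ w ∈ positiveSpectralSubspace T lam, ∀ i,
      ‖ev i w‖ ≤ M * lam ^ (α / 4) * ‖w‖) :
    ∃ L : ℝ, 0 ≤ L ∧ ∀ (y : H) (s : Finset ι),
      ∑ i ∈ s, ‖ev i (T y)‖ ^ (2 + 4 / (α - 2)) ≤
        L * √(inner ℂ (T (T y)) (T y)).re ^ (2 + 4 / (α - 2)) := by
  classical
  -- Here `q` is the Sobolev exponent minus two, chosen so that `r ^ q = 2`.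
  set q : ℝ := 4 / (α - 2) with hq
  set r : ℝ := (2 : ℝ) ^ (α / 4 - 1 / 2) with hr
  have hq0 : 0 < q := div_pos (by norm_num) (by linarith)
  have hr1 : 1 < r := Real.one_lt_rpow (by norm_num) (by linarith)
  have hr0 : 0 < r - 1 := by linarith
  set B : ℝ := M * 4 ^ (α / 4) / (r - 1) with hB
  have hB0 : 0 < B := by positivity
  have hrq : ∀ j : ℤ, (r ^ j) ^ q = 2 ^ j := by
    intro j
    rw [hr, ← Real.rpow_intCast, ← Real.rpow_intCast, ← Real.rpow_mul (by positivity),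
      ← Real.rpow_mul (by norm_num)]
    congr 1
    have : α - 2 ≠ 0 := by linarith
    rw [hq]; field_simp; ring
  refine ⟨16 * (2 * B) ^ q, by positivity, fun y s => ?_⟩
  set x := T y with hx
  set D : ℝ := √(inner ℂ (T x) x).re with hD
  have hDsq : (inner ℂ (T x) x).re = D ^ 2 :=
    (Real.sq_sqrt (((ContinuousLinearMap.nonneg_iff_isPositive T).mp hT).re_inner_nonneg_left
      x)).symm
  set v : ℤ → H := fun j => cfc (dyadicCutoff j) T x with hv
  have hhigh : ∀ J : Finset ℤ, ∑ j ∈ J, (2 : ℝ) ^ j * ‖v j‖ ^ 2 ≤ 2 * D ^ 2 := fun J =>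
    (sum_zpow_mul_norm_dyadicCutoff_sq_le hT J x).trans_eq (by rw [hDsq])
  have hlow : ∀ (j : ℤ) (i : ι), ‖ev i x - ev i (v j)‖ ≤ B * D * r ^ j := by
    intro j i
    refine (norm_sub_cfc_dyadicCutoff_apply_le hT hM.le hα
      (ev i) (fun lam hl w hw => hev lam hl w hw i) j y).trans_eq ?_
    rw [hB, mul_div_right_comm]
  have hD0 : 0 ≤ D := Real.sqrt_nonneg _
  have key : ∀ i : ι, ∃ j : ℤ,
      ‖ev i x‖ ^ (2 + q) ≤ 8 * (2 * B * D) ^ q * ((2 : ℝ) ^ j * ‖ev i (v j)‖ ^ 2) := by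
    intro i
    rcases eq_or_ne (ev i x) 0 with h0 | h0
    · refine ⟨0, ?_⟩
      rw [h0, norm_zero, Real.zero_rpow (by linarith)]
      positivity
    have ha : 0 < ‖ev i x‖ := norm_pos_iff.mpr h0
    -- If `D = 0`, the high and low parts both vanish, so there is no nonzero coordinate and no
    -- scale to choose.
    rcases hD0.eq_or_lt with hD' | hD'
    · exfalso
      have h1 := hlow 0 i
      have h2 := hhigh {0}
      rw [← hD'] at h1 h2
      have h3 : ‖v 0‖ = 0 := by
        have : ‖v 0‖ ^ 2 ≤ 0 := by simpa using h2
        exact pow_eq_zero_iff two_ne_zero |>.mp (le_antisymm this (by positivity))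
      rw [norm_eq_zero.mp h3] at h1
      simp at h1
      exact h0 h1
    -- The lower bound on this quotient makes the low-frequency part at most half of `ev i x`; the
    -- upper bound turns `‖ev i x‖ ^ q` into a multiple of `2 ^ j`.
    obtain ⟨j, hj1, hj2⟩ := exists_mem_Ico_zpow (x := ‖ev i x‖ / (2 * B * D)) (y := r)
      (by positivity) hr1
    refine ⟨j, ?_⟩
    have h1 : ‖ev i x‖ / 2 ≤ ‖ev i (v j)‖ := by
      have h2 : ‖ev i x‖ ≤ ‖ev i x - ev i (v j)‖ + ‖ev i (v j)‖ := by
        simpa using norm_add_le (ev i x - ev i (v j)) (ev i (v j))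
      rw [le_div_iff₀ (by positivity)] at hj1
      linarith [hlow j i]
    have h2 : ‖ev i x‖ ^ q ≤ (2 * B * D) ^ q * (2 * 2 ^ j) := by
      rw [← div_le_iff₀' (by positivity), ← Real.div_rpow ha.le (by positivity)]
      refine (Real.rpow_le_rpow (by positivity) hj2.le hq0.le).trans_eq ?_
      rw [hrq, zpow_add_one₀ (by norm_num), mul_comm]
    have h3 : ‖ev i x‖ ^ 2 ≤ 4 * ‖ev i (v j)‖ ^ 2 := by
      have := pow_le_pow_left₀ (by positivity) h1 2
      rw [div_pow] at this
      linarith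
    calc ‖ev i x‖ ^ (2 + q) = ‖ev i x‖ ^ 2 * ‖ev i x‖ ^ q := by
          rw [Real.rpow_add ha]; norm_cast
      _ ≤ (4 * ‖ev i (v j)‖ ^ 2) * ((2 * B * D) ^ q * (2 * 2 ^ j)) := by gcongr
      _ = _ := by ring
  choose j hj using key
  -- The scale depends on `i`. Allowing every occurring scale for every `i` only enlarges the sum
  -- and decouples the indices, so Bessel applies scale by scale.
  have hsum : ∑ i ∈ s, (2 : ℝ) ^ j i * ‖ev i (v (j i))‖ ^ 2 ≤ 2 * D ^ 2 :=
    calc ∑ i ∈ s, (2 : ℝ) ^ j i * ‖ev i (v (j i))‖ ^ 2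
        ≤ ∑ i ∈ s, ∑ m ∈ s.image j, (2 : ℝ) ^ m * ‖ev i (v m)‖ ^ 2 :=
          Finset.sum_le_sum fun i hi =>
            Finset.single_le_sum (f := fun m : ℤ => (2 : ℝ) ^ m * ‖ev i (v m)‖ ^ 2)
              (fun m _ => by positivity) (Finset.mem_image_of_mem j hi)
      _ = ∑ m ∈ s.image j, (2 : ℝ) ^ m * ∑ i ∈ s, ‖ev i (v m)‖ ^ 2 := by
          rw [Finset.sum_comm]; simp only [Finset.mul_sum]
      _ ≤ ∑ m ∈ s.image j, (2 : ℝ) ^ m * ‖v m‖ ^ 2 := by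
          gcongr
          exact hbessel _ _
      _ ≤ 2 * D ^ 2 := hhigh _
  calc ∑ i ∈ s, ‖ev i x‖ ^ (2 + q)
      ≤ ∑ i ∈ s, 8 * (2 * B * D) ^ q * ((2 : ℝ) ^ j i * ‖ev i (v (j i))‖ ^ 2) :=
        Finset.sum_le_sum fun i _ => hj i
    _ = 8 * (2 * B * D) ^ q * ∑ i ∈ s, (2 : ℝ) ^ j i * ‖ev i (v (j i))‖ ^ 2 := by
        rw [Finset.mul_sum]
    _ ≤ 8 * (2 * B * D) ^ q * (2 * D ^ 2) := by gcongr
    _ = 16 * (2 * B) ^ q * D ^ (2 + q) := by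
        rw [Real.mul_rpow (by positivity) hD0, Real.rpow_add' hD0 (by positivity)]
        norm_cast
        ring

end Sobolev

/-! ### Invariance of spectral subspaces and pointwise bounds -/

section Invariance

variable {H : Type u} [NormedAddCommGroup H] [InnerProductSpace ℂ H] [CompleteSpace H]

theorem apply_mem_positiveSpectralSubspace {T U : H →L[ℂ] H} (hT : IsSelfAdjoint T)
    (hU : Commute T U) {lam : ℝ} {x : H} (hx : x ∈ positiveSpectralSubspace T lam) :
    U x ∈ positiveSpectralSubspace T lam := by
  obtain ⟨h1, h2⟩ := hx
  constructor
  · simp only [spectralSubspace, SetLike.mem_coe, Submodule.mem_iInf] at h1 ⊢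
    intro f
    have hc : Commute (cfc (f.1 : ℝ → ℝ) T) U := hU.cfc (by rwa [hT.star_eq]) _
    have h3 : cfc (f.1 : ℝ → ℝ) T x = 0 := h1 f
    have h4 : cfc (f.1 : ℝ → ℝ) T (U x) = U (cfc (f.1 : ℝ → ℝ) T x) :=
      congrArg (fun S : H →L[ℂ] H => S x) hc.eq
    change cfc (f.1 : ℝ → ℝ) T (U x) = 0
    rw [h4, h3, map_zero]
  · have hc : Commute T (ContinuousLinearMap.adjoint U) := by
      have := hU.star_star
      rwa [hT.star_eq] at this
    rw [SetLike.mem_coe, Submodule.mem_orthogonal] at h2 ⊢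
    intro y hy
    rw [← ContinuousLinearMap.adjoint_inner_left]
    refine h2 _ ?_
    have h4 : T (ContinuousLinearMap.adjoint U y) = ContinuousLinearMap.adjoint U (T y) :=
      congrArg (fun S : H →L[ℂ] H => S y) hc.eq
    change T (ContinuousLinearMap.adjoint U y) = 0
    rw [h4, show T y = 0 from hy, map_zero]

/-- Cauchy–Schwarz after moving the projection `P` onto `e`, together with `‖P e‖² = ⟨P e, e⟩`. -/
theorem norm_inner_le_of_mem_positiveSpectralSubspace (T : H →L[ℂ] H) {lam F : ℝ} {e x : H}
    (hF : (inner ℂ (spectralProjection T lam e) e).re ≤ F)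
    (hx : x ∈ positiveSpectralSubspace T lam) : ‖inner ℂ e x‖ ≤ √F * ‖x‖ := by
  have h1 : inner ℂ e x = inner ℂ (spectralProjection T lam e) x := by
    rw [spectralProjection, Submodule.inner_starProjection_left_eq_right,
      Submodule.starProjection_eq_self_iff.mpr hx]
  have h2 : ‖spectralProjection T lam e‖ ^ 2 ≤ F := by
    refine le_trans (le_of_eq ?_) hF
    have h3 : spectralProjection T lam (spectralProjection T lam e) = spectralProjection T lam e :=
      Submodule.starProjection_eq_self_iff.mpr (Submodule.starProjection_apply_mem _ _)
    have h4 : inner ℂ (spectralProjection T lam e) e =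
        inner ℂ (spectralProjection T lam e) (spectralProjection T lam e) := by
      conv_lhs => rw [← h3]
      exact Submodule.inner_starProjection_left_eq_right _ _ _
    rw [h4, inner_self_eq_norm_sq_to_K]
    norm_cast
  rw [h1]
  refine (norm_inner_le_norm _ _).trans ?_
  gcongr
  exact Real.le_sqrt_of_sq_le h2

end Invariance

/-! ### Translations -/

theorem sum_norm_sq_le_norm_sq {ι : Type*} (c : lp (fun _ : ι => ℂ) 2) (s : Finset ι) :
    ∑ i ∈ s, ‖c i‖ ^ 2 ≤ ‖c‖ ^ 2 := by
  simpa using lp.sum_rpow_le_norm_rpow (p := 2) (by norm_num) c s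

/-- Composition with a permutation of the index set, as a bounded operator of `ℓ²`. -/
def compEquivL2 {ι : Type*} (e : ι ≃ ι) :
    lp (fun _ : ι => ℂ) 2 →L[ℂ] lp (fun _ : ι => ℂ) 2 :=
  have hb : ∀ (c : lp (fun _ : ι => ℂ) 2) (s : Finset ι), ∑ i ∈ s, ‖c (e i)‖ ^ 2 ≤ ‖c‖ ^ 2 :=
    fun c s => by
      simpa using sum_norm_sq_le_norm_sq c (s.map e.toEmbedding)
  LinearMap.mkContinuous
    { toFun := fun c => ⟨fun i => c (e i),
        memℓp_gen' (C := ‖c‖ ^ 2) fun s => by simpa using hb c s⟩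
      map_add' := fun _ _ => rfl
      map_smul' := fun _ _ => rfl } 1 fun c => by
    refine lp.norm_le_of_forall_sum_le (p := 2) (by norm_num) (by positivity) fun s => ?_
    simp only [one_mul, ENNReal.toReal_ofNat, Real.rpow_ofNat]
    exact hb c s

@[simp]
theorem compEquivL2_apply {ι : Type*} (e : ι ≃ ι) (c : lp (fun _ : ι => ℂ) 2) (i : ι) :
    compEquivL2 e c i = c (e i) := rfl

theorem norm_compEquivL2_le {ι : Type*} (e : ι ≃ ι) (c : lp (fun _ : ι => ℂ) 2) :
    ‖compEquivL2 e c‖ ≤ ‖c‖ := by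
  refine lp.norm_le_of_forall_sum_le (p := 2) (by norm_num) (norm_nonneg c) fun s => ?_
  simpa using sum_norm_sq_le_norm_sq c (s.map e.toEmbedding)

theorem adjoint_compEquivL2 {ι : Type*} (e : ι ≃ ι) :
    ContinuousLinearMap.adjoint (compEquivL2 e) = compEquivL2 e.symm := by
  symm
  rw [ContinuousLinearMap.eq_adjoint_iff]
  intro x y
  rw [lp.inner_eq_tsum, lp.inner_eq_tsum, ← e.tsum_eq]
  simp

namespace Covering

section

variable {Γ : Type w} [Group Γ] {V : Type u} {W : Type v} [MulAction Γ V]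
  {X : AbstractSimplicialComplex V} {K : AbstractSimplicialComplex W}

open Classical in
/-- The action of `Γ` on the simplices of `X`. -/
def translate (π : Covering Γ X K) {k : ℕ} (g : Γ) (σ : Simplex X k) : Simplex X k :=
  ⟨σ.1.image (fun x => g • x), π.smul_mem g _ σ.2.1, by
    rw [Finset.card_image_of_injective _ (MulAction.injective g), σ.2.2]⟩

theorem mem_translate (π : Covering Γ X K) {k : ℕ} (g : Γ) (σ : Simplex X k) (x : V) :
    x ∈ (π.translate g σ).1 ↔ ∃ y ∈ σ.1, g • y = x := by
  classical
  simp [translate]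

theorem smul_mem_translate_iff (π : Covering Γ X K) {k : ℕ} (g : Γ) (σ : Simplex X k) (x : V) :
    g • x ∈ (π.translate g σ).1 ↔ x ∈ σ.1 := by
  simp [mem_translate]

theorem translate_mul (π : Covering Γ X K) {k : ℕ} (g h : Γ) (σ : Simplex X k) :
    π.translate g (π.translate h σ) = π.translate (g * h) σ := by
  ext x
  simp [mem_translate, mul_smul]

theorem translate_one (π : Covering Γ X K) {k : ℕ} (σ : Simplex X k) :
    π.translate 1 σ = σ := by
  ext x
  simp [mem_translate]

/-- The translation of simplices by an element of `Γ`, as a permutation. -/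
def translateEquiv (π : Covering Γ X K) (k : ℕ) (g : Γ) : Simplex X k ≃ Simplex X k where
  toFun := π.translate g
  invFun := π.translate g⁻¹
  left_inv σ := by rw [translate_mul, inv_mul_cancel, translate_one]
  right_inv σ := by rw [translate_mul, mul_inv_cancel, translate_one]

@[simp]
theorem translateEquiv_apply (π : Covering Γ X K) (k : ℕ) (g : Γ) (σ : Simplex X k) :
    π.translateEquiv k g σ = π.translate g σ := rfl

theorem translateEquiv_symm (π : Covering Γ X K) (k : ℕ) (g : Γ) :
    (π.translateEquiv k g).symm = π.translateEquiv k g⁻¹ := by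
  ext; simp [translateEquiv]

theorem proj_smul (π : Covering Γ X K) (g : Γ) (x : V) : π.proj (g • x) = π.proj x :=
  ((π.proj_eq_iff _ _).mpr ⟨g, rfl⟩).symm

theorem translate_opposite (π : Covering Γ X K) {k : ℕ} (g : Γ) (σ : Simplex X (k + 1)) (x : V)
    (hx : x ∈ σ.1) :
    π.translate g (σ.opposite x hx) =
      (π.translate g σ).opposite (g • x) ((π.smul_mem_translate_iff g σ x).mpr hx) := by
  classical
  apply Subtype.ext
  simp only [translate, Simplex.opposite]
  rw [Finset.image_erase (MulAction.injective g)]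

/-- Some `g` moves a vertex of the chosen lift to a vertex of `σ` in the same fibre; uniqueness of
lifts through that vertex does the rest. -/
theorem exists_translate_lift (π : Covering Γ X K) {k : ℕ} (σ : Simplex X k) :
    ∃ g : Γ, π.translate g (π.lift (π.image σ)) = σ := by
  classical
  have himg : (π.lift (π.image σ)).1.image π.proj = σ.1.image π.proj := by
    have h := (π.exists_lift (π.image σ)).choose_spec
    simp only [Covering.image] at h
    convert h
    rfl
  set ρ := π.lift (π.image σ)
  obtain ⟨y, hy⟩ : σ.1.Nonempty := Finset.card_pos.mp (by rw [σ.2.2]; omega)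
  obtain ⟨x, hx, hxy⟩ := Finset.mem_image.mp (himg ▸ Finset.mem_image_of_mem π.proj hy)
  obtain ⟨g, rfl⟩ := (π.proj_eq_iff _ _).mp hxy
  refine ⟨g, Subtype.ext ?_⟩
  have hu := π.existsUnique_lift _ (π.image_mem _ σ.2.1) (g • x)
    (by rw [Finset.mem_image]; exact ⟨_, hy, rfl⟩)
  refine hu.unique ⟨(π.translate g ρ).2.1, (π.smul_mem_translate_iff g ρ x).mpr hx, ?_⟩
    ⟨σ.2.1, hy, by convert rfl⟩
  ext z
  have h2 := congrArg (z ∈ ·) himg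
  simp only [Finset.mem_image, eq_iff_iff] at h2
  simp only [Finset.mem_image, mem_translate]
  rw [← h2]
  constructor
  · rintro ⟨_, ⟨a, ha, rfl⟩, rfl⟩
    exact ⟨a, ha, (π.proj_smul g a).symm⟩
  · rintro ⟨a, ha, rfl⟩
    exact ⟨_, ⟨a, ha, rfl⟩, π.proj_smul g a⟩

end

/-! ### Equivariance of the coboundary and the pointwise spectral bound -/

section

variable {Γ : Type w} [Group Γ] {V : Type u} {W : Type v} [LinearOrder W] [MulAction Γ V]
  {X : AbstractSimplicialComplex V} {K : AbstractSimplicialComplex W}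

theorem d_comp_translate (π : Covering Γ X K) (k : ℕ) (g : Γ) (c : Cochain X k)
    (σ : Simplex X (k + 1)) :
    π.d k (fun τ => c (π.translate g τ)) σ = π.d k c (π.translate g σ) := by
  classical
  simp only [d, LinearMap.coe_mk, AddHom.coe_mk]
  refine Fintype.sum_bijective
    (fun x : {x // x ∈ σ.1} => (⟨g • x.1, (π.smul_mem_translate_iff g σ x).mpr x.2⟩ :
      {x // x ∈ (π.translate g σ).1})) ⟨?_, ?_⟩ _ _ ?_
  · intro x y h
    exact Subtype.ext (MulAction.injective g (congrArg Subtype.val h))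
  · rintro ⟨y, hy⟩
    obtain ⟨x, hx, rfl⟩ := (π.mem_translate g σ y).mp hy
    exact ⟨⟨x, hx⟩, rfl⟩
  · rintro ⟨x, hx⟩
    rw [translate_opposite]
    congr 2
    refine Finset.card_bij (fun y _ => g • y) ?_ ?_ ?_
    · intro y hy
      simpa [proj_smul, smul_mem_translate_iff] using hy
    · intro y _ z _ h
      exact MulAction.injective g h
    · intro z hz
      rw [Finset.mem_filter, mem_translate] at hz
      obtain ⟨⟨y, hy, rfl⟩, hlt⟩ := hz
      refine ⟨y, ?_, rfl⟩
      simpa [proj_smul, hy] using hlt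

variable [Finite W]

theorem dL2_comp_translate (π : Covering Γ X K) (k : ℕ) (g : Γ) :
    π.dL2 k ∘L compEquivL2 (π.translateEquiv k g) =
      compEquivL2 (π.translateEquiv (k + 1) g) ∘L π.dL2 k := by
  ext c σ
  exact π.d_comp_translate k g c σ

theorem commute_A_translate (π : Covering Γ X K) (k : ℕ) (g : Γ) :
    Commute (π.A k) (compEquivL2 (π.translateEquiv k g)) := by
  have h1 : ContinuousLinearMap.adjoint (π.dL2 k) ∘L compEquivL2 (π.translateEquiv (k + 1) g) =
      compEquivL2 (π.translateEquiv k g) ∘L ContinuousLinearMap.adjoint (π.dL2 k) := by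
    have h2 := congrArg ContinuousLinearMap.adjoint (π.dL2_comp_translate k g⁻¹)
    rw [ContinuousLinearMap.adjoint_comp, ContinuousLinearMap.adjoint_comp, adjoint_compEquivL2,
      adjoint_compEquivL2, translateEquiv_symm, translateEquiv_symm, inv_inv] at h2
    exact h2.symm
  change (ContinuousLinearMap.adjoint (π.dL2 k) ∘L π.dL2 k) ∘L _ =
    _ ∘L (ContinuousLinearMap.adjoint (π.dL2 k) ∘L π.dL2 k)
  rw [ContinuousLinearMap.comp_assoc, dL2_comp_translate, ← ContinuousLinearMap.comp_assoc, h1,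
    ContinuousLinearMap.comp_assoc]

theorem A_nonneg (π : Covering Γ X K) (k : ℕ) : 0 ≤ π.A k :=
  (ContinuousLinearMap.nonneg_iff_isPositive _).mpr
    (ContinuousLinearMap.isPositive_adjoint_comp_self _)

theorem re_inner_A_apply (π : Covering Γ X K) (k : ℕ) (x : L2 X k) :
    (inner ℂ (π.A k x) x).re = ‖π.dL2 k x‖ ^ 2 := by
  change (inner ℂ (ContinuousLinearMap.adjoint (π.dL2 k) (π.dL2 k x)) x).re = _
  rw [ContinuousLinearMap.adjoint_inner_left, inner_self_eq_norm_sq_to_K]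
  norm_cast

/-- Translating `x` moves its value at `σ` to the chosen lift without leaving the spectral subspace.
There the diagonal coefficient is one of the nonnegative terms of the trace. -/
theorem norm_apply_le_of_mem_positiveSpectralSubspace (π : Covering Γ X K) (k : ℕ) {lam F : ℝ}
    (hF : π.spectralDensity k lam ≤ F) {x : L2 X k}
    (hx : x ∈ positiveSpectralSubspace (π.A k) lam) (σ : Simplex X k) :
    ‖x σ‖ ≤ √F * ‖x‖ := by
  classical
  obtain ⟨g, hg⟩ := π.exists_translate_lift σ
  set ρ := π.lift (π.image σ) with hρ
  have hmem := apply_mem_positiveSpectralSubspace (IsSelfAdjoint.of_nonneg (π.A_nonneg k))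
    (π.commute_A_translate k g) hx
  have hle : (inner ℂ (spectralProjection (π.A k) lam (lp.single 2 ρ (1 : ℂ)))
      (lp.single 2 ρ (1 : ℂ))).re ≤ F := by
    refine le_trans ?_ hF
    rw [spectralDensity, gammaTrace]
    have h := Finset.single_le_sum (s := Finset.univ) (f := fun τ : Simplex K k =>
      (inner ℂ (spectralProjection (π.A k) lam (lp.single 2 (π.lift τ) (1 : ℂ)))
        (lp.single 2 (π.lift τ) (1 : ℂ))).re) (fun τ _ => ?_) (Finset.mem_univ (π.image σ))
    · convert h
    · exact (ContinuousLinearMap.IsPositive.of_isStarProjection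
        (isStarProjection_starProjection (U := positiveSpectralSubspace (π.A k) lam))).re_inner_nonneg_left
        _
  have h := norm_inner_le_of_mem_positiveSpectralSubspace (π.A k) hle hmem
  rw [lp.inner_single_left] at h
  simp only [compEquivL2_apply, translateEquiv_apply, hg, RCLike.inner_apply, map_one,
    mul_one] at h
  exact h.trans (mul_le_mul_of_nonneg_left (norm_compEquivL2_le _ _) (Real.sqrt_nonneg _))

end

end Covering

/-! ### The coboundary complex and its Sobolev inequality -/

theorem Simplex.mem_opposite {V : Type u} {X : AbstractSimplicialComplex V} {k : ℕ}
    (σ : Simplex X (k + 1)) {x y : V} (hx : x ∈ σ.1) :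
    y ∈ (σ.opposite x hx).1 ↔ y ≠ x ∧ y ∈ σ.1 := by
  classical
  simp [Simplex.opposite]

/-- If `z` is orthogonal to the range of `S S* S`, then `S* S S* z = 0`, hence `S S* z = 0`, hence
`S* z = 0`. With `S = d_k`, primitives in the range of `A` suffice for approximation. -/
theorem topologicalClosure_range_le {H H' : Type*} [NormedAddCommGroup H] [InnerProductSpace ℂ H]
    [CompleteSpace H] [NormedAddCommGroup H'] [InnerProductSpace ℂ H'] [CompleteSpace H']
    (S : H →L[ℂ] H') :
    (LinearMap.range S.toLinearMap).topologicalClosure ≤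
      (LinearMap.range
        (S ∘L ContinuousLinearMap.adjoint S ∘L S).toLinearMap).topologicalClosure := by
  rw [← Submodule.orthogonal_orthogonal_eq_closure, ← Submodule.orthogonal_orthogonal_eq_closure]
  refine Submodule.orthogonal_le fun z hz => ?_
  rw [Submodule.mem_orthogonal] at hz ⊢
  have h1 : ∀ y, inner ℂ (S (ContinuousLinearMap.adjoint S (S y))) z = 0 :=
    fun y => hz _ ⟨y, rfl⟩
  have h2 : S (ContinuousLinearMap.adjoint S z) = 0 := by
    have h3 : ContinuousLinearMap.adjoint S (S (ContinuousLinearMap.adjoint S z)) = 0 := by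
      rw [← inner_self_eq_zero (𝕜 := ℂ)]
      rw [ContinuousLinearMap.adjoint_inner_left, ← ContinuousLinearMap.adjoint_inner_right,
        ContinuousLinearMap.adjoint_inner_left, ← inner_conj_symm, h1, map_zero]
    rw [← inner_self_eq_zero (𝕜 := ℂ), ← ContinuousLinearMap.adjoint_inner_right, h3,
      inner_zero_right]
  have h4 : ContinuousLinearMap.adjoint S z = 0 := by
    rw [← inner_self_eq_zero (𝕜 := ℂ), ContinuousLinearMap.adjoint_inner_right, h2,
      inner_zero_left]
  rintro _ ⟨y, rfl⟩
  change inner ℂ (S y) z = 0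
  rw [← ContinuousLinearMap.adjoint_inner_right, h4, inner_zero_right]

namespace Covering

section

variable {Γ : Type w} [Group Γ] {V : Type u} {W : Type v} [LinearOrder W] [MulAction Γ V]
  {X : AbstractSimplicialComplex V} {K : AbstractSimplicialComplex W}

/-- The incidence sign of the face of `σ` opposite to `x`. -/
def sign (π : Covering Γ X K) {k : ℕ} (σ : Simplex X k) (x : V) : ℂ :=
  (-1) ^ (σ.1.filter (fun y => π.proj y < π.proj x)).card

theorem d_apply (π : Covering Γ X K) (k : ℕ) (c : Cochain X k) (σ : Simplex X (k + 1)) :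
    π.d k c σ = ∑ x : {x // x ∈ σ.1}, π.sign σ x * c (σ.opposite x.1 x.2) := rfl

theorem sign_opposite (π : Covering Γ X K) {k : ℕ} (σ : Simplex X (k + 1)) {x : V}
    (hx : x ∈ σ.1) (y : V) :
    π.sign (σ.opposite x hx) y = (if π.proj x < π.proj y then -1 else 1) * π.sign σ y := by
  classical
  have h : ((σ.opposite x hx).1.filter fun z => π.proj z < π.proj y) =
      (σ.1.filter fun z => π.proj z < π.proj y).erase x := by
    ext z
    simp only [Finset.mem_filter, Simplex.mem_opposite, Finset.mem_erase]
    tauto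
  rw [sign, sign, h]
  split_ifs with hlt
  · have hm : x ∈ σ.1.filter fun z => π.proj z < π.proj y := Finset.mem_filter.mpr ⟨hx, hlt⟩
    rw [← Finset.card_erase_add_one hm, pow_succ]
    ring
  · have hm : x ∉ σ.1.filter fun z => π.proj z < π.proj y :=
      fun hm => hlt (Finset.mem_filter.mp hm).2
    rw [Finset.erase_eq_of_notMem hm, one_mul]

/-- Deleting `x` then `y` cancels against deleting `y` then `x`: by `sign_opposite` exactly one of
the two orders changes a sign, since the projections of `x` and `y` differ. -/
theorem d_d (π : Covering Γ X K) (k : ℕ) (c : Cochain X k) : π.d (k + 1) (π.d k c) = 0 := by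
  classical
  funext σ
  simp only [d_apply, Finset.mul_sum, Pi.zero_apply]
  rw [Finset.sum_sigma']
  refine Finset.sum_involution
    (fun q _ => ⟨⟨q.2.1, ((σ.mem_opposite q.1.2).mp q.2.2).2⟩, ⟨q.1.1,
      (σ.mem_opposite _).mpr ⟨((σ.mem_opposite q.1.2).mp q.2.2).1.symm, q.1.2⟩⟩⟩)
    ?_ ?_ ?_ ?_
  · rintro ⟨⟨x, hx⟩, ⟨y, hy⟩⟩ -
    obtain ⟨hne, hyσ⟩ := (σ.mem_opposite hx).mp hy
    have hpne : π.proj y ≠ π.proj x := fun h => hne (π.injOn _ σ.2.1 hyσ hx h)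
    have hface : ∀ h, (σ.opposite x hx).opposite y hy = (σ.opposite y hyσ).opposite x h := by
      intro h
      apply Subtype.ext
      ext z
      simp only [Simplex.mem_opposite]
      tauto
    simp only [sign_opposite]
    rw [hface ((σ.mem_opposite _).mpr ⟨hne.symm, hx⟩)]
    rcases hpne.lt_or_gt with h | h
    · rw [if_pos h, if_neg h.not_gt]; ring
    · rw [if_pos h, if_neg h.not_gt]; ring
  · rintro ⟨⟨x, hx⟩, ⟨y, hy⟩⟩ - - h
    exact ((σ.mem_opposite hx).mp hy).1 (congrArg (fun q => q.1.1) h)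
  · intro q _; simp
  · intro q _; rfl

theorem tendsto_d_apply (π : Covering Γ X K) (k : ℕ) {ι : Type*} {l : Filter ι}
    {x : ι → Cochain X k} {c : Cochain X k}
    (h : ∀ σ, Filter.Tendsto (fun n => x n σ) l (nhds (c σ))) (σ : Simplex X (k + 1)) :
    Filter.Tendsto (fun n => π.d k (x n) σ) l (nhds (π.d k c σ)) := by
  simp only [d_apply]
  exact tendsto_finsetSum _ fun y _ => (h _).const_mul _

theorem B_mono (π : Covering Γ X K) {p q : ℝ≥0∞} (h : p ≤ q) (k : ℕ) : π.B p k ≤ π.B q k := by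
  rintro b ⟨c, hc, hcb⟩
  exact ⟨c, hc.of_exponent_ge h, hcb⟩

/-! ### From the Sobolev inequality to primitives -/

variable [Finite W]

theorem B_le_ker (π : Covering Γ X K) (p : ℝ≥0∞) (k : ℕ) :
    π.B p k ≤ LinearMap.ker (π.dL2 (k + 1)).toLinearMap := by
  rintro b ⟨c, -, hc⟩
  change π.dL2 (k + 1) b = 0
  ext σ
  rw [coe_dL2, ← hc, d_d]
  rfl

theorem ker_le_closedCoboundaries (π : Covering Γ X K) (k : ℕ)
    (hH : Subsingleton (π.ReducedL2Cohomology k)) :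
    LinearMap.ker (π.dL2 (k + 1)).toLinearMap ≤ π.closedCoboundaries k := by
  have h := Submodule.Quotient.subsingleton_iff.mp hH
  intro b hb
  have h2 : (⟨b, hb⟩ : LinearMap.ker (π.dL2 (k + 1)).toLinearMap) ∈
      (π.closedCoboundaries k).submoduleOf (LinearMap.ker (π.dL2 (k + 1)).toLinearMap) := by
    rw [h]; trivial
  exact h2

/-- The Sobolev inequality for the coboundary, on the range of `A = d_k^* d_k`. -/
theorem exists_sobolev_constant (π : Covering Γ X K) (k : ℕ) {C α : ℝ} (hα : 2 < α)
    (hF : ∀ lam : ℝ, 0 < lam → π.spectralDensity k lam ≤ C * lam ^ (α / 2)) :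
    ∃ L : ℝ, 0 ≤ L ∧ ∀ (y : L2 X k) (s : Finset (Simplex X k)),
      ∑ σ ∈ s, ‖π.A k y σ‖ ^ (2 + 4 / (α - 2)) ≤
        L * ‖π.dL2 k (π.A k y)‖ ^ (2 + 4 / (α - 2)) := by
  -- The maximum with one keeps `M` positive whatever the sign of `C`.
  have hM : (0 : ℝ) < √(max C 1) := Real.sqrt_pos.mpr (lt_max_of_lt_right one_pos)
  obtain ⟨L, hL, h⟩ := L2Torsion.exists_sobolev_constant (π.A_nonneg k)
    (fun σ => lp.evalCLM ℂ (fun _ : Simplex X k => ℂ) 2 σ)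
    (fun w s => sum_norm_sq_le_norm_sq w s) hM hα (fun lam hlam w hw σ => by
      have h1 : π.spectralDensity k lam ≤ max C 1 * (lam ^ (α / 4)) ^ 2 := by
        refine (hF lam hlam).trans ?_
        rw [← Real.rpow_natCast, ← Real.rpow_mul hlam.le]
        rw [show α / 4 * ((2 : ℕ) : ℝ) = α / 2 by push_cast; ring]
        gcongr
        exact le_max_left _ _
      have h2 := π.norm_apply_le_of_mem_positiveSpectralSubspace k h1 hw σ
      rwa [Real.sqrt_mul (le_max_of_le_right zero_le_one),
        Real.sqrt_sq (by positivity)] at h2)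
  refine ⟨L, hL, fun y s => ?_⟩
  have h1 := h y s
  rw [re_inner_A_apply, Real.sqrt_sq (norm_nonneg _)] at h1
  exact h1

theorem closedCoboundaries_le_B (π : Covering Γ X K) (k : ℕ) {C α : ℝ} (hα : 2 < α)
    (hF : ∀ lam : ℝ, 0 < lam → π.spectralDensity k lam ≤ C * lam ^ (α / 2)) :
    π.closedCoboundaries k ≤ π.B (ENNReal.ofReal (2 + 4 / (α - 2))) k := by
  obtain ⟨L, hL, hsob⟩ := π.exists_sobolev_constant k hα hF
  set q : ℝ := 2 + 4 / (α - 2) with hq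
  have hq0 : 0 < q := add_pos two_pos (div_pos four_pos (by linarith))
  intro b hb
  have hb' := topologicalClosure_range_le (π.dL2 k) hb
  obtain ⟨z, hz, hzb⟩ := mem_closure_iff_seq_limit.mp hb'
  choose y hy using hz
  have hd : ∀ n, π.dL2 k (π.A k (y n)) = z n := hy
  -- The Sobolev inequality on one simplex; applied to differences, it makes the primitives Cauchy
  -- at each simplex.
  have hpt : ∀ (y : L2 X k) (σ : Simplex X k),
      ‖π.A k y σ‖ ≤ L ^ q⁻¹ * ‖π.dL2 k (π.A k y)‖ := by
    intro y σ
    have h := hsob y {σ}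
    rw [Finset.sum_singleton] at h
    have h2 := Real.rpow_le_rpow (by positivity) h (inv_nonneg.mpr hq0.le)
    rwa [Real.mul_rpow hL (by positivity), Real.rpow_rpow_inv (norm_nonneg _) hq0.ne',
      Real.rpow_rpow_inv (norm_nonneg _) hq0.ne'] at h2
  have hcauchy : ∀ σ, CauchySeq fun n => π.A k (y n) σ := by
    intro σ
    refine Metric.cauchySeq_iff'.mpr fun ε hε => ?_
    obtain ⟨N, hN⟩ := Metric.cauchySeq_iff'.mp hzb.cauchySeq (ε / (L ^ q⁻¹ + 1)) (by positivity)
    refine ⟨N, fun n hn => ?_⟩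
    have h := hpt (y n - y N) σ
    rw [map_sub, map_sub, hd, hd] at h
    have h2 := hN n hn
    rw [dist_eq_norm, lt_div_iff₀ (by positivity)] at h2
    rw [dist_eq_norm]
    refine lt_of_le_of_lt h ?_
    nlinarith [norm_nonneg (z n - z N)]
  choose c hc using fun σ => cauchySeq_tendsto_of_complete (hcauchy σ)
  refine ⟨c, memℓp_gen' (C := L * ‖b‖ ^ q) fun s => ?_, ?_⟩
  -- Fatou's argument: the bound passes to the limit on each finite set of simplices.
  · rw [ENNReal.toReal_ofReal hq0.le]
    refine le_of_tendsto_of_tendsto'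
      (tendsto_finsetSum s fun σ _ => (hc σ).norm.rpow_const (Or.inr hq0.le))
      ((hzb.norm.rpow_const (Or.inr hq0.le)).const_mul L) fun n => ?_
    rw [← hd]
    exact hsob (y n) s
  -- Each value of `d` is a finite sum, so pointwise convergence of the primitives gives `d c`,
  -- while `ℓ²` convergence gives `b`.
  · funext σ
    refine tendsto_nhds_unique (π.tendsto_d_apply k hc σ) ?_
    have h := ((lp.evalCLM ℂ (fun _ : Simplex X (k + 1) => ℂ) 2 σ).continuous.tendsto b).comp hzb
    refine h.congr fun n => ?_
    rw [Function.comp_apply, ← hd]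
    rfl

end

end Covering

theorem ofReal_sobolevExponent_le {α : ℝ} (hα : 2 < α) {p : ℝ≥0∞}
    (hp : 1 / p ≤ ENNReal.ofReal (1 / 2 - 1 / α)) :
    ENNReal.ofReal (2 + 4 / (α - 2)) ≤ p := by
  have h0 : 0 < α - 2 := by linarith
  have h1 : 1 / 2 - 1 / α = (2 + 4 / (α - 2))⁻¹ := by
    have : α ≠ 0 := by linarith
    field_simp
    ring
  rw [h1, ENNReal.ofReal_inv_of_pos (by positivity), one_div] at hp
  exact ENNReal.inv_le_inv.mp hp

end L2Torsion

end

theorem mainTheorem9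
    {Γ : Type*} [Group Γ] {V W : Type*} [MulAction Γ V] [Finite W] [LinearOrder W]
    {X : AbstractSimplicialComplex V} {K : AbstractSimplicialComplex W}
    (π : L2Torsion.Covering Γ X K) (k : ℕ)
    (C α : ℝ) (hα : 2 < α)
    (hF : ∀ lam : ℝ, 0 < lam → π.spectralDensity k lam ≤ C * lam ^ (α / 2))
    (hH : Subsingleton (π.ReducedL2Cohomology k))
    (p : ℝ≥0∞) (hp : 1 / p ≤ ENNReal.ofReal (1 / 2 - 1 / α)) :
    π.B p k = π.closedCoboundaries k ∧ Subsingleton (π.Torsion p k) := by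
  have hB : π.B p k = π.closedCoboundaries k :=
    le_antisymm ((π.B_le_ker p k).trans (π.ker_le_closedCoboundaries k hH))
      ((π.closedCoboundaries_le_B k hα hF).trans
        (π.B_mono (L2Torsion.ofReal_sobolevExponent_le hα hp) k))
  refine ⟨hB, Submodule.Quotient.subsingleton_iff.mpr ?_⟩
  -- Being equal to a closure, `B` is closed, so the torsion is a quotient of `B` by itself.
  have hcl : (π.B p k).topologicalClosure = π.B p k := by
    rw [hB]
    exact (Submodule.isClosed_topologicalClosure _).submodule_topologicalClosure_eq
  rw [hcl]
  exact Submodule.submoduleOf_self _
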